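/- Fix $n>2$ players and a constant $c\in(0,1]$. For a set $M$ of $m$ indivisible items, a valuation is a function $v:2^M\to\mathbb{R}_{\ge 0}$ that is monotone, has $v(\emptyset)=0$ and $v(M)>0$; it is submodular if $v(T\cup\{g\})-v(T)\le v(S\cup\{g\})-v(S)$ whenever $S\subseteq T\subseteq M$ and $g\in M$. An allocation is a partition $(A_1,\dots,A_n)$ of $M$ into $n$ disjoint, possibly empty bundles; it is $c$-EF for the valuations $(v_1,\dots,v_n)$ if $v_i(A_i)\ge c\cdot v_i(A_j)$ for all $i,j$. Each player $i$ knows only her own valuation $v_i$. In a protocol, the messages sent so far determine which player acts next, every message is seen by all players, each bit sent depends on the sender's valuation and on the messages so far, and the protocol ends when a player declares a result (the declaration itself is not counted as communication and may depend on her own valuation). A randomized protocol is public-coin: all players also see infinite streams of independent fair random bits, on which every step may depend. It must give a correct result with probability at least $2/3$ for every profile of submodular valuations, and its cost is the maximum number of bits sent, over all profiles of submodular valuations and all outcomes of the random bits. Let $R_{submod}(n,m,\mathrm{EF},c)$ be the minimum cost of a randomized protocol that finds a $c$-EF allocation or declares that none exists, and let $R^{dec}_{submod}(n,m,\mathrm{EF},c)$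 be the minimum cost of a randomized protocol that only determines whether a $c$-EF allocation exists. Theorem. For every fixed $n>2$ and every fixed $c\in(0,1]$, as $k\to\infty$, $$R^{dec}_{submod}(n,2k+n-2,\mathrm{EF},c)=\Omega\left(\binom{2k}{k}\right)\quad\text{and}\quad R_{submod}(n,2k+n-2,\mathrm{EF},c)=\Omega\left(\binom{2k}{k}\right).$$ -/

import Mathlib

open Filter Asymptotics MeasureTheory

namespace FairDivision

/-- A valuation on the item set `Fin m`: a normalized, monotone function from bundles to the
nonnegative reals, with positive value for the set of all items. -/
structure Valuation (m : ℕ) where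
  val : Finset (Fin m) → ℝ
  nonneg : ∀ S, 0 ≤ val S
  empty : val ∅ = 0
  mono : ∀ S T, S ⊆ T → val S ≤ val T
  pos : 0 < val Finset.univ

/-- Diminishing marginal values. -/
def Valuation.IsSubmodular {m : ℕ} (v : Valuation m) : Prop :=
  ∀ (S T : Finset (Fin m)) (g : Fin m), S ⊆ T →
    v.val (insert g T) - v.val T ≤ v.val (insert g S) - v.val S

/-- The submodular valuations on `m` items: the private input of one player. -/
def SubmodularValuation (m : ℕ) : Type := {v : Valuation m // v.IsSubmodular}

/-- A partition of the `m` items into `n` (possibly empty) bundles, given by the owner of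
each item. -/
abbrev Allocation (n m : ℕ) : Type := Fin m → Fin n

/-- The bundle that player `i` receives. -/
def Allocation.bundle {n m : ℕ} (A : Allocation n m) (i : Fin n) : Finset (Fin m) :=
  Finset.univ.filter fun g => A g = i

/-- The allocation `A` is `c`-EF for the valuations `v`. -/
def IsEF {n m : ℕ} (c : ℝ) (v : Fin n → SubmodularValuation m) (A : Allocation n m) : Prop :=
  ∀ i j : Fin n, c * (v i).1.val (A.bundle j) ≤ (v i).1.val (A.bundle i)

/-- A deterministic `n`-party protocol in which every message is seen by all players; `V` is the
type of the private input of one player, `O` the type of results. The messages sent so far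
determine who acts next. That player either sends one bit, which depends on her own input, or
ends the protocol by declaring a result, which may also depend on her own input. -/
inductive Protocol (n : ℕ) (V O : Type) : Type
  | declare (i : Fin n) (result : V → O) : Protocol n V O
  | send (i : Fin n) (bit : V → Bool) (next : Bool → Protocol n V O) : Protocol n V O

/-- The declared result on the inputs `v`. -/
def Protocol.output {n : ℕ} {V O : Type} : Protocol n V O → (Fin n → V) → O
  | .declare i result, v => result (v i)
  | .send i bit next, v => (next (bit (v i))).output v

/-- The number of bits sent on the inputs `v`. -/
def Protocol.bits {n : ℕ} {V O : Type} : Protocol n V O → (Fin n → V) → ℕ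
  | .declare _ _, _ => 0
  | .send i bit next, v => (next (bit (v i))).bits v + 1

/-- An infinite stream of bits for each of the `n` players. -/
abbrev Coins (n : ℕ) : Type := Fin n × ℕ → Bool

/-- All bits of all streams are independent and fair. -/
noncomputable def coinMeasure (n : ℕ) : Measure (Coins n) :=
  Measure.infinitePi fun _ => (PMF.uniformOfFintype Bool).toMeasure

/-- A public-coin randomized protocol: all players see all random bits, and so every outcome of
the random bits gives a deterministic protocol. The result on any fixed inputs is a random
variable. -/
structure RandomizedProtocol (n : ℕ) (V O : Type) where
  det : Coins n → Protocol n V O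
  measurable_output : ∀ (v : Fin n → V) (o : O), MeasurableSet {ω | (det ω).output v = o}

/-- On all inputs, the result meets the specification with probability at least `2/3`. -/
def RandomizedProtocol.IsCorrect {n : ℕ} {V O : Type} (Γ : RandomizedProtocol n V O)
    (spec : (Fin n → V) → O → Prop) : Prop :=
  ∀ v : Fin n → V, 2 / 3 ≤ (coinMeasure n).real {ω | spec v ((Γ.det ω).output v)}

/-- At most `b` bits are sent, for all inputs and all outcomes of the random bits. -/
def RandomizedProtocol.CostAtMost {n : ℕ} {V O : Type} (Γ : RandomizedProtocol n V O)
    (b : ℕ) : Prop :=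
  ∀ (ω : Coins n) (v : Fin n → V), (Γ.det ω).bits v ≤ b

/-- The randomized communication complexity of a problem: the minimum worst-case cost of a
correct public-coin protocol. -/
noncomputable def randomizedComplexity {n : ℕ} {V O : Type} (spec : (Fin n → V) → O → Prop) : ℕ :=
  sInf {b | ∃ Γ : RandomizedProtocol n V O, Γ.IsCorrect spec ∧ Γ.CostAtMost b}

/-- Determine whether a `c`-EF allocation exists. -/
def decideEF (n m : ℕ) (c : ℝ) (v : Fin n → SubmodularValuation m) (o : Bool) : Prop :=
  o = true ↔ ∃ A : Allocation n m, IsEF c v A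

/-- Find a `c`-EF allocation, or declare (by `none`) that there is none. -/
def findEF (n m : ℕ) (c : ℝ) (v : Fin n → SubmodularValuation m) :
    Option (Allocation n m) → Prop
  | some A => IsEF c v A
  | none => ¬ ∃ A : Allocation n m, IsEF c v A

/-- The complexity of deciding whether a `c`-EF allocation exists, for submodular valuations. -/
noncomputable def RsubmodDecideEF (n m : ℕ) (c : ℝ) : ℕ :=
  randomizedComplexity (decideEF n m c)

/-- The complexity `R_submod(n, m, EF, c)` of the fair division problem. -/
noncomputable def RsubmodEF (n m : ℕ) (c : ℝ) : ℕ :=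
  randomizedComplexity (findEF n m c)

end FairDivision

/-! Set disjointness on `(2 * k).choose k` coordinates reduces to deciding whether a `c`-EF
allocation exists. Index the coordinates by the halves `S` of a set of `2 * k` main items. Two
distinguished players value a set of fewer than `k` main items by its size and a larger one by `k`,
less `1 / 2` on the sets of size `k` outside a family that encodes the player's input; submodularity
survives since marginal values drop from `1` to `0` at size `k`. Each other player wants only a
private item, which she must receive, and which the distinguished players value at `k / c`. So
envy-freeness requires value `k` for both of them from the main items, that is, a half in each
player's family, and these halves are complementary. The second family consists of complements, so
such a split is an intersection.

For set disjointness, the probability of a fixed answer of a protocol of cost `b` is, as a function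
of the two inputs, dominated by `2 ^ b` rectangles, by averaging over the random bits. For every
rectangle `f x * g y`, the mass on intersecting pairs is nearly at least a constant fraction of that
on disjoint pairs (Razborov's corruption bound). Draw disjoint pairs by first drawing which side
owns each coordinate, `d`, and compare `d` with its flip at `i`. If `i` is unbiased for its owner in
both cases, then comparable mass lies on the pairs that intersect at `i`. By an entropy argument,
more than `N / 20` of the `N` coordinates are biased only if the rectangle has exponentially small
mass. A correct protocol distinguishes disjoint from intersecting pairs, so `2 ^ b` must compensate
that exponentially small error. -/

namespace FairDivision

section Cube

variable {ι : Type*} [DecidableEq ι]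

/-- The point `d` of the cube with coordinate `i` negated. -/
def flipAt (i : ι) (d : ι → Bool) : ι → Bool := Function.update d i (!d i)

lemma flipAt_apply_self (i : ι) (d : ι → Bool) : flipAt i d i = !d i := by simp [flipAt]

lemma flipAt_apply_of_ne {i j : ι} (h : j ≠ i) (d : ι → Bool) : flipAt i d j = d j := by
  simp [flipAt, h]

lemma flipAt_involutive (i : ι) : Function.Involutive (flipAt i) := by
  intro d
  simp [flipAt]

lemma compl_flipAt (i : ι) (d : ι → Bool) : (flipAt i d)ᶜ = flipAt i dᶜ := by
  ext j
  rcases eq_or_ne j i with rfl | h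
  · simp [flipAt_apply_self]
  · simp [flipAt_apply_of_ne h]

lemma update_flipAt_inf (i : ι) (β : Bool) (d x : ι → Bool) :
    Function.update (flipAt i d ⊓ x) i β = Function.update (d ⊓ x) i β := by
  ext j
  rcases eq_or_ne j i with rfl | h
  · simp
  · simp [flipAt_apply_of_ne h, h]

lemma inf_update_of_eq_true {i : ι} {d : ι → Bool} (h : d i = true) (β : Bool) (x : ι → Bool) :
    d ⊓ Function.update x i β = Function.update (d ⊓ x) i β := by
  ext j
  rcases eq_or_ne j i with rfl | hj
  · simp [h]
  · simp [hj]

variable [Fintype ι]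

lemma sum_comp_flipAt (i : ι) (F : (ι → Bool) → ℝ) : ∑ x, F (flipAt i x) = ∑ x, F x :=
  Equiv.sum_comp (flipAt_involutive i).toPerm F

lemma sum_comp_update (F : (ι → Bool) → ℝ) (i : ι) (β : Bool) :
    ∑ x, F (Function.update x i β) = 2 * ∑ x with x i = β, F x := by
  have fiber (x : ι → Bool) : F (Function.update x i β)
      = (if x i = β then F x else 0) + if flipAt i x i = β then F (flipAt i x) else 0 := by
    by_cases hx : x i = β
    · have hflip : flipAt i x i ≠ β := by simp [flipAt_apply_self, hx]
      rw [if_pos hx, if_neg hflip, add_zero, ← hx, Function.update_eq_self]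
    · have hflip : (!x i) = β := Bool.not_eq.2 hx
      rw [if_neg hx, flipAt_apply_self, if_pos hflip, zero_add, flipAt, hflip]
  simp only [fiber, Finset.sum_add_distrib,
    sum_comp_flipAt i fun x => if x i = β then F x else 0, Finset.sum_filter, two_mul]

section BiasedWeight

/-- The factor by which a biased coordinate is reweighted: above one on agreement with the
majority bit and below one on disagreement. Its average over a fair bit is below one, and it does
not decrease the mass of a weight that agrees with the majority bit with frequency at least
`3 / 4`. -/
noncomputable def agreementWeight (a b : Bool) : ℝ := if a = b then 5 / 4 else (5 / 4)⁻¹ ^ 3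

lemma agreementWeight_pos (a b : Bool) : 0 < agreementWeight a b := by
  unfold agreementWeight
  split_ifs <;> positivity

lemma log_agreementWeight (a b : Bool) :
    Real.log (agreementWeight a b) = 4 * Real.log (5 / 4) * ((if a = b then 1 else 0) - 3 / 4) := by
  unfold agreementWeight
  split_ifs
  · ring
  · rw [Real.log_pow, Real.log_inv]
    push_cast
    ring

lemma sum_prod_agreementWeight (T : Finset ι) (s : ι → Bool) :
    ∑ x : ι → Bool, ∏ i ∈ T, agreementWeight (x i) (s i)
      = 2 ^ Fintype.card ι * (881 / 1000) ^ T.card := by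
  have average (i : ι) : ∑ β, (if i ∈ T then agreementWeight β (s i) else 1)
      = 2 * if i ∈ T then (881 / 1000 : ℝ) else 1 := by
    by_cases hi : i ∈ T
    · cases s i <;> norm_num [agreementWeight, hi]
    · simp [hi]
  calc ∑ x : ι → Bool, ∏ i ∈ T, agreementWeight (x i) (s i)
      = ∑ x : ι → Bool, ∏ i, if i ∈ T then agreementWeight (x i) (s i) else 1 := by
        simp only [Finset.prod_ite_mem, Finset.univ_inter]
    _ = ∏ i, ∑ β, if i ∈ T then agreementWeight β (s i) else 1 :=
        (Fintype.prod_sum fun i β => if i ∈ T then agreementWeight β (s i) else 1).symm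
    _ = 2 ^ Fintype.card ι * (881 / 1000) ^ T.card := by
        simp only [average, Finset.prod_mul_distrib, Finset.prod_ite_mem, Finset.univ_inter,
          Finset.prod_const, Finset.card_univ]

variable {φ : (ι → Bool) → ℝ} {T : Finset ι} {s : ι → Bool}

lemma sum_le_sum_mul_prod_agreementWeight (φ_nonneg : ∀ x, 0 ≤ φ x)
    (biased : ∀ i ∈ T, 3 / 4 * ∑ x, φ x ≤ ∑ x with x i = s i, φ x) :
    ∑ x, φ x ≤ ∑ x, φ x * ∏ i ∈ T, agreementWeight (x i) (s i) := by
  have log_mass_nonneg : 0 ≤ ∑ x, φ x * ∑ i ∈ T, Real.log (agreementWeight (x i) (s i)) := by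
    have coordinate (i : ι) : ∑ x, φ x * Real.log (agreementWeight (x i) (s i))
        = 4 * Real.log (5 / 4) * (∑ x with x i = s i, φ x - 3 / 4 * ∑ x, φ x) := by
      rw [Finset.sum_filter, Finset.mul_sum, ← Finset.sum_sub_distrib, Finset.mul_sum]
      refine Finset.sum_congr rfl fun x _ => ?_
      rw [log_agreementWeight]
      split_ifs <;> ring
    simp_rw [Finset.mul_sum]
    rw [Finset.sum_comm]
    refine Finset.sum_nonneg fun i hi => ?_
    rw [coordinate]
    have := Real.log_nonneg (by norm_num : (1 : ℝ) ≤ 5 / 4)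
    exact mul_nonneg (by positivity) (sub_nonneg.2 (biased i hi))
  have add_log_le (x : ι → Bool) :
      φ x + φ x * ∑ i ∈ T, Real.log (agreementWeight (x i) (s i))
        ≤ φ x * ∏ i ∈ T, agreementWeight (x i) (s i) := by
    have := Real.log_le_sub_one_of_pos
      (Finset.prod_pos fun i (_ : i ∈ T) => agreementWeight_pos (x i) (s i))
    rw [Real.log_prod fun i _ => (agreementWeight_pos (x i) (s i)).ne'] at this
    linarith [mul_le_mul_of_nonneg_left this (φ_nonneg x)]
  have := Finset.sum_le_sum fun x (_ : x ∈ Finset.univ) => add_log_le x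
  rw [Finset.sum_add_distrib] at this
  linarith

lemma sum_le_of_biased (φ_nonneg : ∀ x, 0 ≤ φ x) (φ_le_one : ∀ x, φ x ≤ 1)
    (biased : ∀ i ∈ T, 3 / 4 * ∑ x, φ x ≤ ∑ x with x i = s i, φ x) :
    ∑ x, φ x ≤ 2 ^ Fintype.card ι * (9 / 10) ^ T.card :=
  calc ∑ x, φ x ≤ ∑ x, φ x * ∏ i ∈ T, agreementWeight (x i) (s i) :=
        sum_le_sum_mul_prod_agreementWeight φ_nonneg biased
    _ ≤ ∑ x : ι → Bool, ∏ i ∈ T, agreementWeight (x i) (s i) :=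
        Finset.sum_le_sum fun x _ => mul_le_of_le_one_left
          (Finset.prod_nonneg fun i _ => (agreementWeight_pos (x i) (s i)).le) (φ_le_one x)
    _ ≤ 2 ^ Fintype.card ι * (9 / 10) ^ T.card := by
        rw [sum_prod_agreementWeight]
        exact mul_le_mul_of_nonneg_left
          (pow_le_pow_left₀ (by norm_num) (by norm_num) _) (by positivity)

end BiasedWeight

/-- The mass of `f` on the subcube of the points supported on `d`, each counted once for every
point of the cube that restricts to it. -/
def subcubeMass (f : (ι → Bool) → ℝ) (d : ι → Bool) : ℝ := ∑ x, f (d ⊓ x)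

/-- The mass of `f` on the subcube of the points supported on `d`, after coordinate `i` is
replaced by `β`. -/
def sliceMass (f : (ι → Bool) → ℝ) (i : ι) (β : Bool) (d : ι → Bool) : ℝ :=
  ∑ x, f (Function.update (d ⊓ x) i β)

section Mass

variable {f : (ι → Bool) → ℝ} {i : ι} {d : ι → Bool}

lemma subcubeMass_nonneg (f_nonneg : ∀ x, 0 ≤ f x) (d : ι → Bool) : 0 ≤ subcubeMass f d :=
  Finset.sum_nonneg fun _ _ => f_nonneg _

lemma sliceMass_nonneg (f_nonneg : ∀ x, 0 ≤ f x) (i : ι) (β : Bool) (d : ι → Bool) :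
    0 ≤ sliceMass f i β d :=
  Finset.sum_nonneg fun _ _ => f_nonneg _

lemma subcubeMass_le (f_le_one : ∀ x, f x ≤ 1) (d : ι → Bool) :
    subcubeMass f d ≤ 2 ^ Fintype.card ι :=
  (Finset.sum_le_sum fun x _ => f_le_one (d ⊓ x)).trans (by simp)

lemma sliceMass_flipAt (f : (ι → Bool) → ℝ) (i : ι) (β : Bool) (d : ι → Bool) :
    sliceMass f i β (flipAt i d) = sliceMass f i β d := by
  simp only [sliceMass, update_flipAt_inf]

lemma subcubeMass_of_eq_false (f : (ι → Bool) → ℝ) (h : d i = false) :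
    subcubeMass f d = sliceMass f i false d := by
  refine Finset.sum_congr rfl fun x _ => congrArg f ?_
  rw [eq_comm, Function.update_eq_self_iff]
  simp [h]

lemma sliceMass_of_eq_true (f : (ι → Bool) → ℝ) (h : d i = true) (β : Bool) :
    sliceMass f i β d = 2 * ∑ x with x i = β, f (d ⊓ x) := by
  simp only [sliceMass, ← inf_update_of_eq_true h, sum_comp_update fun x => f (d ⊓ x)]

lemma two_mul_subcubeMass_of_eq_true (f : (ι → Bool) → ℝ) (h : d i = true) (β : Bool) :
    2 * subcubeMass f d = sliceMass f i β d + sliceMass f i (!β) d := by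
  rw [sliceMass_of_eq_true f h, sliceMass_of_eq_true f h, ← mul_add, subcubeMass,
    ← Finset.sum_filter_add_sum_filter_not Finset.univ (fun x : ι → Bool => x i = β)]
  simp only [Bool.eq_not]

open Classical in
/-- The coordinates in the support of `d` that are far from uniform under `f` on the subcube of
`d`: one of their two values has frequency below `1 / 4`. -/
noncomputable def biasedCoords (f : (ι → Bool) → ℝ) (d : ι → Bool) : Finset ι :=
  {i | d i = true ∧ ∃ β, 2 * sliceMass f i β d < subcubeMass f d}

lemma notMem_biasedCoords_of_eq_false (f : (ι → Bool) → ℝ) (h : d i = false) :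
    i ∉ biasedCoords f d := by
  simp [biasedCoords, h]

lemma subcubeMass_le_two_mul_sliceMass (h : d i = true) (hi : i ∉ biasedCoords f d) (β : Bool) :
    subcubeMass f d ≤ 2 * sliceMass f i β d := by
  simp only [biasedCoords, Finset.mem_filter_univ, h, true_and, not_exists, not_lt] at hi
  exact hi β

lemma exists_frequent_value_of_mem_biasedCoords (hi : i ∈ biasedCoords f d) :
    ∃ β, 3 / 4 * subcubeMass f d ≤ ∑ x with x i = β, f (d ⊓ x) := by
  simp only [biasedCoords, Finset.mem_filter_univ] at hi
  obtain ⟨h, β, rare⟩ := hi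
  refine ⟨!β, ?_⟩
  linarith [two_mul_subcubeMass_of_eq_true f h β, sliceMass_of_eq_true f h (!β)]

lemma subcubeMass_le_pow_card_biasedCoords (f_nonneg : ∀ x, 0 ≤ f x) (f_le_one : ∀ x, f x ≤ 1)
    (d : ι → Bool) :
    subcubeMass f d ≤ 2 ^ Fintype.card ι * (9 / 10) ^ (biasedCoords f d).card := by
  have : ∀ i, ∃ β, i ∈ biasedCoords f d →
      3 / 4 * subcubeMass f d ≤ ∑ x with x i = β, f (d ⊓ x) := fun i => by
    by_cases hi : i ∈ biasedCoords f d
    · exact (exists_frequent_value_of_mem_biasedCoords hi).imp fun β h _ => h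
    · exact ⟨true, fun h => absurd h hi⟩
  choose s frequent using this
  exact sum_le_of_biased (s := s) (fun _ => f_nonneg _) (fun _ => f_le_one _) frequent

lemma subcubeMass_mul_card_biasedCoords_le (f_nonneg : ∀ x, 0 ≤ f x) (f_le_one : ∀ x, f x ≤ 1)
    (d : ι → Bool) :
    subcubeMass f d * (biasedCoords f d).card ≤ subcubeMass f d * (Fintype.card ι / 20)
      + Fintype.card ι * 2 ^ Fintype.card ι * (9 / 10) ^ (Fintype.card ι / 20) := by
  set N := Fintype.card ι
  have mass_nonneg := subcubeMass_nonneg f_nonneg d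
  rcases le_or_gt (biasedCoords f d).card (N / 20) with few | many
  · have : ((biasedCoords f d).card : ℝ) ≤ N / 20 :=
      (Nat.cast_le.2 few).trans (by simpa using Nat.cast_div_le (α := ℝ) (m := N) (n := 20))
    have := mul_le_mul_of_nonneg_left this mass_nonneg
    have : (0 : ℝ) ≤ N * 2 ^ N * (9 / 10) ^ (N / 20) := by positivity
    linarith
  · have mass_le : subcubeMass f d ≤ 2 ^ N * (9 / 10) ^ (N / 20) :=
      (subcubeMass_le_pow_card_biasedCoords f_nonneg f_le_one d).trans <|
        mul_le_mul_of_nonneg_left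
          (pow_le_pow_of_le_one (by norm_num) (by norm_num) many.le) (by positivity)
    have card_le : ((biasedCoords f d).card : ℝ) ≤ N := Nat.cast_le.2 (Finset.card_le_univ _)
    have : subcubeMass f d * (biasedCoords f d).card ≤ 2 ^ N * (9 / 10) ^ (N / 20) * N := by
      gcongr
    have : 0 ≤ subcubeMass f d * ((N : ℝ) / 20) := by positivity
    linarith

end Mass

section Corruption

variable {f g : (ι → Bool) → ℝ}

/-- The product mass of the complementary subcubes of `d` and `dᶜ`, penalized if `i` is biased in
one of them. The penalty `5` is what `slice_product_bound` needs. -/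
noncomputable def penalizedMass (f g : (ι → Bool) → ℝ) (i : ι) (d : ι → Bool) : ℝ :=
  subcubeMass f d * subcubeMass g dᶜ *
    (1 - 5 * ((if i ∈ biasedCoords f d then 1 else 0) + if i ∈ biasedCoords g dᶜ then 1 else 0))

lemma slice_product_bound {a a₀ a₁ b b₀ b₁ : ℝ} {p q : Prop} [Decidable p] [Decidable q]
    (ha₀ : 0 ≤ a₀) (ha₁ : 0 ≤ a₁) (hb₀ : 0 ≤ b₀) (hb₁ : 0 ≤ b₁)
    (ha : 2 * a = a₁ + a₀) (hb : 2 * b = b₁ + b₀)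
    (hp : ¬p → a ≤ 2 * a₀ ∧ a ≤ 2 * a₁) (hq : ¬q → b ≤ 2 * b₀ ∧ b ≤ 2 * b₁) :
    a * b₀ * (1 - 5 * if p then 1 else 0) + a₀ * b * (1 - 5 * if q then 1 else 0)
      ≤ 16 * (a₁ * b₁) := by
  have a_nonneg : 0 ≤ a := by linarith
  have b_nonneg : 0 ≤ b := by linarith
  have ones_nonneg : 0 ≤ a₁ * b₁ := mul_nonneg ha₁ hb₁
  have ab₀_nonneg : 0 ≤ a * b₀ := mul_nonneg a_nonneg hb₀
  have a₀b_nonneg : 0 ≤ a₀ * b := mul_nonneg ha₀ b_nonneg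
  have a₀_le : a₀ ≤ 2 * a := by linarith
  have b₀_le : b₀ ≤ 2 * b := by linarith
  split_ifs with hp' hq' hq'
  · linarith
  · have : a₀ * b ≤ (2 * a) * (2 * b₀) := by gcongr; exact (hq hq').1
    linarith
  · have : a * b₀ ≤ (2 * a₀) * (2 * b) := by gcongr; exact (hp hp').1
    linarith
  · have : a * b ≤ (2 * a₁) * (2 * b₁) := by gcongr; exacts [(hp hp').2, (hq hq').2]
    have : a * b₀ ≤ a * (2 * b) := by gcongr
    have : a₀ * b ≤ (2 * a) * b := by gcongr
    linarith

lemma penalizedMass_add_flipAt_le_of_eq_true (f_nonneg : ∀ x, 0 ≤ f x) (g_nonneg : ∀ x, 0 ≤ g x)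
    {i : ι} {d : ι → Bool} (h : d i = true) :
    penalizedMass f g i d + penalizedMass f g i (flipAt i d)
      ≤ 16 * (sliceMass f i true d * sliceMass g i true dᶜ) := by
  have flip_false : flipAt i d i = false := by simp [flipAt_apply_self, h]
  have compl_false : dᶜ i = false := by simp [h]
  have flip_compl_true : flipAt i dᶜ i = true := by simp [flipAt_apply_self, h]
  have g_mass := two_mul_subcubeMass_of_eq_true g flip_compl_true true
  have g_unbiased := subcubeMass_le_two_mul_sliceMass (f := g) flip_compl_true
  simp only [sliceMass_flipAt] at g_mass g_unbiased
  simp only [penalizedMass, compl_flipAt, notMem_biasedCoords_of_eq_false f flip_false,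
    notMem_biasedCoords_of_eq_false g compl_false, if_false, add_zero, zero_add,
    subcubeMass_of_eq_false g compl_false, subcubeMass_of_eq_false f flip_false, sliceMass_flipAt]
  have f_slice := sliceMass_nonneg f_nonneg i
  have g_slice := sliceMass_nonneg g_nonneg i
  exact slice_product_bound (f_slice _ _) (f_slice _ _) (g_slice _ _) (g_slice _ _)
    (two_mul_subcubeMass_of_eq_true f h true) g_mass
    (fun hi => ⟨subcubeMass_le_two_mul_sliceMass h hi _, subcubeMass_le_two_mul_sliceMass h hi _⟩)
    fun hi => ⟨g_unbiased hi _, g_unbiased hi _⟩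

lemma penalizedMass_add_flipAt_le (f_nonneg : ∀ x, 0 ≤ f x) (g_nonneg : ∀ x, 0 ≤ g x)
    (i : ι) (d : ι → Bool) :
    penalizedMass f g i d + penalizedMass f g i (flipAt i d)
      ≤ 16 * (sliceMass f i true d * sliceMass g i true dᶜ) := by
  cases h : d i
  · have := penalizedMass_add_flipAt_le_of_eq_true f_nonneg g_nonneg (i := i) (d := flipAt i d)
      (by simp [flipAt_apply_self, h])
    rwa [flipAt_involutive i d, compl_flipAt, sliceMass_flipAt, sliceMass_flipAt, add_comm] at this
  · exact penalizedMass_add_flipAt_le_of_eq_true f_nonneg g_nonneg h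

lemma sum_penalizedMass_le (f_nonneg : ∀ x, 0 ≤ f x) (g_nonneg : ∀ x, 0 ≤ g x) (i : ι) :
    ∑ d, penalizedMass f g i d ≤ 8 * ∑ d, sliceMass f i true d * sliceMass g i true dᶜ := by
  have := Finset.sum_le_sum fun d (_ : d ∈ Finset.univ) =>
    penalizedMass_add_flipAt_le f_nonneg g_nonneg i d
  rw [Finset.sum_add_distrib, sum_comp_flipAt i (penalizedMass f g i), ← Finset.mul_sum] at this
  linarith

lemma sum_coords_penalizedMass (f g : (ι → Bool) → ℝ) (d : ι → Bool) :
    ∑ i, penalizedMass f g i d = subcubeMass f d * subcubeMass g dᶜ *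
      (Fintype.card ι - 5 * ((biasedCoords f d).card + (biasedCoords g dᶜ).card)) := by
  simp [penalizedMass, ← Finset.mul_sum, Finset.sum_add_distrib]

lemma le_sum_coords_penalizedMass (f_nonneg : ∀ x, 0 ≤ f x) (f_le_one : ∀ x, f x ≤ 1)
    (g_nonneg : ∀ x, 0 ≤ g x) (g_le_one : ∀ x, g x ≤ 1) (d : ι → Bool) :
    Fintype.card ι / 2 * (subcubeMass f d * subcubeMass g dᶜ)
        - 10 * (Fintype.card ι * 4 ^ Fintype.card ι * (9 / 10) ^ (Fintype.card ι / 20))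
      ≤ ∑ i, penalizedMass f g i d := by
  set N := Fintype.card ι
  set E : ℝ := N * 2 ^ N * (9 / 10) ^ (N / 20) with hE
  have : 0 ≤ E := by positivity
  have error_le {a : ℝ} (ha : a ≤ 2 ^ N) : a * E ≤ N * 4 ^ N * (9 / 10) ^ (N / 20) :=
    calc a * E ≤ 2 ^ N * E := by gcongr
      _ = N * 4 ^ N * (9 / 10) ^ (N / 20) := by
        rw [hE, (by norm_num : (4 : ℝ) = 2 * 2), mul_pow]
        ring
  have f_biased := mul_le_mul_of_nonneg_left
    (subcubeMass_mul_card_biasedCoords_le f_nonneg f_le_one d) (subcubeMass_nonneg g_nonneg dᶜ)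
  have g_biased := mul_le_mul_of_nonneg_left
    (subcubeMass_mul_card_biasedCoords_le g_nonneg g_le_one dᶜ) (subcubeMass_nonneg f_nonneg d)
  have f_error := error_le (subcubeMass_le g_le_one dᶜ)
  have g_error := error_le (subcubeMass_le f_le_one d)
  rw [sum_coords_penalizedMass]
  linarith

/-- The unnormalized distribution on disjoint pairs that is hard for set disjointness, as a linear
functional: a uniformly random side of each coordinate is zero, and the other side is a uniformly
random bit. -/
def disjointMass : ((ι → Bool) → (ι → Bool) → ℝ) →ₗ[ℝ] ℝ where
  toFun P := ∑ d, ∑ x, ∑ y, P (d ⊓ x) (dᶜ ⊓ y)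
  map_add' P Q := by simp [Finset.sum_add_distrib]
  map_smul' a P := by simp [Finset.mul_sum]

/-- The unnormalized hard distribution on pairs that intersect, as a linear functional: a pair as
in `disjointMass`, changed to one on both sides of a uniformly random coordinate. -/
def intersectingMass : ((ι → Bool) → (ι → Bool) → ℝ) →ₗ[ℝ] ℝ where
  toFun P := ∑ i, ∑ d, ∑ x, ∑ y,
    P (Function.update (d ⊓ x) i true) (Function.update (dᶜ ⊓ y) i true)
  map_add' P Q := by simp [Finset.sum_add_distrib]
  map_smul' a P := by simp [Finset.mul_sum]

lemma disjointMass_apply (P : (ι → Bool) → (ι → Bool) → ℝ) :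
    disjointMass P = ∑ d, ∑ x, ∑ y, P (d ⊓ x) (dᶜ ⊓ y) :=
  rfl

lemma intersectingMass_apply (P : (ι → Bool) → (ι → Bool) → ℝ) :
    intersectingMass P = ∑ i, ∑ d, ∑ x, ∑ y,
      P (Function.update (d ⊓ x) i true) (Function.update (dᶜ ⊓ y) i true) :=
  rfl

lemma disjointMass_rectangle (f g : (ι → Bool) → ℝ) :
    disjointMass (fun x y => f x * g y) = ∑ d, subcubeMass f d * subcubeMass g dᶜ := by
  simp only [disjointMass_apply, subcubeMass, Finset.sum_mul_sum]

lemma intersectingMass_rectangle (f g : (ι → Bool) → ℝ) :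
    intersectingMass (fun x y => f x * g y)
      = ∑ i, ∑ d, sliceMass f i true d * sliceMass g i true dᶜ := by
  simp only [intersectingMass_apply, sliceMass, Finset.sum_mul_sum]

lemma corruption_bound (f_nonneg : ∀ x, 0 ≤ f x) (f_le_one : ∀ x, f x ≤ 1)
    (g_nonneg : ∀ x, 0 ≤ g x) (g_le_one : ∀ x, g x ≤ 1) :
    Fintype.card ι / 16 * disjointMass (fun x y => f x * g y)
        - intersectingMass (fun x y => f x * g y)
      ≤ 5 / 4 * (Fintype.card ι * 8 ^ Fintype.card ι * (9 / 10) ^ (Fintype.card ι / 20)) := by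
  rw [disjointMass_rectangle, intersectingMass_rectangle]
  have upper := Finset.sum_le_sum fun i (_ : i ∈ Finset.univ) =>
    sum_penalizedMass_le f_nonneg g_nonneg i
  have lower := Finset.sum_le_sum fun d (_ : d ∈ Finset.univ) =>
    le_sum_coords_penalizedMass f_nonneg f_le_one g_nonneg g_le_one d
  rw [← Finset.mul_sum, Finset.sum_comm] at upper
  simp only [Finset.sum_sub_distrib, ← Finset.mul_sum, Finset.sum_const, Finset.card_univ,
    Fintype.card_fun, Fintype.card_bool, nsmul_eq_mul, Nat.cast_pow, Nat.cast_ofNat] at lower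
  have eight_pow : (8 : ℝ) ^ Fintype.card ι = 2 ^ Fintype.card ι * 4 ^ Fintype.card ι := by
    rw [← mul_pow]
    norm_num
  rw [eight_pow]
  linarith

end Corruption

end Cube

section Rectangles

variable {X Y : Type*} {T T' : ℝ} {P Q : X → Y → ℝ}

/-- `P` is dominated by `T` rectangles: a linear functional that is at most `ε` on all products of
functions with values in `[0, 1]` is at most `T * ε` on `P`. By duality, such `P` are (up to
closure) `T` times the convex combinations of these products. -/
def RectBounded (T : ℝ) (P : X → Y → ℝ) : Prop :=
  ∀ (L : (X → Y → ℝ) →ₗ[ℝ] ℝ) (ε : ℝ),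
    (∀ f ∈ Set.Icc (0 : X → ℝ) 1, ∀ g ∈ Set.Icc (0 : Y → ℝ) 1, L (fun x y => f x * g y) ≤ ε) →
      L P ≤ T * ε

lemma mul_mem_Icc_zero_one {f g : X → ℝ} (hf : f ∈ Set.Icc 0 1) (hg : g ∈ Set.Icc 0 1) :
    f * g ∈ Set.Icc 0 1 :=
  ⟨mul_nonneg hf.1 hg.1, mul_le_one₀ hf.2 hg.1 hg.2⟩

open Classical in
lemma indicator_mem_Icc_zero_one (p : X → Prop) :
    (fun x => if p x then (1 : ℝ) else 0) ∈ Set.Icc (0 : X → ℝ) 1 := by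
  constructor <;> intro x <;> simp only [Pi.zero_apply, Pi.one_apply] <;> split_ifs <;> norm_num

lemma one_mem_Icc_zero_one : (1 : X → ℝ) ∈ Set.Icc 0 1 := ⟨zero_le_one, le_rfl⟩

lemma RectBounded.rectangle {f : X → ℝ} {g : Y → ℝ} (hf : f ∈ Set.Icc 0 1)
    (hg : g ∈ Set.Icc 0 1) : RectBounded 1 (fun x y => f x * g y) := fun _ ε hL =>
  (hL f hf g hg).trans_eq (one_mul ε).symm

lemma RectBounded.one : RectBounded 1 (1 : X → Y → ℝ) := by
  simpa using! RectBounded.rectangle (one_mem_Icc_zero_one (X := X)) (one_mem_Icc_zero_one (X := Y))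

lemma RectBounded.zero : RectBounded 0 (0 : X → Y → ℝ) := fun _ _ _ => by simp

lemma RectBounded.mono (hP : RectBounded T P) (hT : T ≤ T') : RectBounded T' P := by
  intro L ε hL
  have hε : 0 ≤ ε := by
    have := hL 0 (by simp) 0 (by simp)
    simp only [Pi.zero_apply, mul_zero] at this
    exact (map_zero L).symm.trans_le this
  exact (hP L ε hL).trans (mul_le_mul_of_nonneg_right hT hε)

lemma RectBounded.add (hP : RectBounded T P) (hQ : RectBounded T' Q) :
    RectBounded (T + T') (P + Q) := by
  intro L ε hL
  rw [map_add, add_mul]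
  exact add_le_add (hP L ε hL) (hQ L ε hL)

lemma RectBounded.mul (hP : RectBounded T P) (hQ : RectBounded T' Q) :
    RectBounded (T * T') (P * Q) := by
  intro L ε hL
  rw [mul_assoc]
  refine hP (L ∘ₗ LinearMap.mulRight ℝ Q) (T' * ε) fun f hf g hg => ?_
  refine hQ (L ∘ₗ LinearMap.mulLeft ℝ fun x y => f x * g y) ε fun f' hf' g' hg' => ?_
  convert hL (f * f') (mul_mem_Icc_zero_one hf hf') (g * g') (mul_mem_Icc_zero_one hg hg') using 1
  simp only [LinearMap.comp_apply, LinearMap.mulLeft_apply]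
  congr 1
  ext x y
  simp only [Pi.mul_apply]
  ring

lemma RectBounded.pow (hP : RectBounded T P) (r : ℕ) : RectBounded (T ^ r) (P ^ r) := by
  induction r with
  | zero => simpa only [pow_zero] using RectBounded.one
  | succ r ih => simpa only [pow_succ] using ih.mul hP

lemma RectBounded.integral [Finite X] [Finite Y] {Ω : Type*} [MeasurableSpace Ω] {μ : Measure Ω}
    [IsProbabilityMeasure μ] {P : Ω → X → Y → ℝ} (hP : ∀ ω, RectBounded T (P ω))
    (integrable : ∀ x y, Integrable (fun ω => P ω x y) μ) :
    RectBounded T (fun x y => ∫ ω, P ω x y ∂μ) := by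
  cases nonempty_fintype X
  cases nonempty_fintype Y
  intro L ε hL
  let L' := LinearMap.toContinuousLinearMap L
  have integrable_row (x : X) : Integrable (fun ω => P ω x) μ := .of_eval (integrable x)
  have integrable_P : Integrable P μ := .of_eval integrable_row
  have integral_eq : (fun x y => ∫ ω, P ω x y ∂μ) = ∫ ω, P ω ∂μ := by
    ext x y
    rw [eval_integral integrable_row, eval_integral (integrable x)]
  calc L (fun x y => ∫ ω, P ω x y ∂μ) = ∫ ω, L' (P ω) ∂μ := by
        rw [integral_eq, L'.integral_comp_comm integrable_P]
        rfl
    _ ≤ ∫ _ω, T * ε ∂μ :=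
        integral_mono (L'.integrable_comp integrable_P) (integrable_const _)
          fun ω => hP ω L ε hL
    _ = T * ε := by simp

end Rectangles

section TwoParty

variable {X Y : Type*} {n : ℕ} {V O : Type} {v : X → Y → Fin n → V}

/-- The inputs of the players are split between two parties: the input of every player is known
to the party with input `x` or to the party with input `y`. -/
def IsTwoParty (v : X → Y → Fin n → V) : Prop :=
  ∀ i, (∃ F : X → V, ∀ x y, v x y i = F x) ∨ ∃ G : Y → V, ∀ x y, v x y i = G y

open Classical in
lemma IsTwoParty.rectBounded_indicator (hv : IsTwoParty v) (i : Fin n) (p : V → Prop) :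
    RectBounded 1 (fun x y => if p (v x y i) then 1 else 0) := by
  rcases hv i with ⟨F, hF⟩ | ⟨G, hG⟩
  · simpa [hF] using! RectBounded.rectangle (indicator_mem_Icc_zero_one fun x => p (F x))
      (one_mem_Icc_zero_one (X := Y))
  · simpa [hG] using! RectBounded.rectangle (one_mem_Icc_zero_one (X := X))
      (indicator_mem_Icc_zero_one fun y => p (G y))

open Classical in
lemma Protocol.rectBounded_output (hv : IsTwoParty v) (o : O) (π : Protocol n V O) (b : ℕ) :
    RectBounded (2 ^ b)
      (fun x y => if π.bits (v x y) ≤ b ∧ π.output (v x y) = o then 1 else 0) := by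
  induction π generalizing b with
  | declare i result =>
    simpa [Protocol.bits, Protocol.output] using
      (hv.rectBounded_indicator i fun w => result w = o).mono
        (one_le_pow₀ (one_le_two (α := ℝ)) (n := b))
  | send i bit next ih =>
    cases b with
    | zero => simpa [Protocol.bits] using! RectBounded.zero.mono (zero_le_one (α := ℝ))
    | succ b =>
      have branch (β : Bool) :=
        (hv.rectBounded_indicator i fun w => bit w = β).mul (ih β b)
      convert (branch true).add (branch false) using 1
      · ring
      · ext x y
        cases h : bit (v x y i) <;> simp [Protocol.bits, Protocol.output, h]

instance (n : ℕ) : IsProbabilityMeasure (coinMeasure n) := by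
  unfold coinMeasure
  infer_instance

/-- The probability that the protocol declares the result `o` on the inputs `v`. -/
noncomputable def RandomizedProtocol.outputProb (Γ : RandomizedProtocol n V O) (o : O)
    (v : Fin n → V) : ℝ :=
  (coinMeasure n).real {ω | (Γ.det ω).output v = o}

lemma RandomizedProtocol.rectBounded_outputProb [Finite X] [Finite Y] (hv : IsTwoParty v)
    {Γ : RandomizedProtocol n V O} {b : ℕ} (hb : Γ.CostAtMost b) (o : O) :
    RectBounded (2 ^ b) (fun x y => Γ.outputProb o (v x y)) := by
  classical
  have measurable (x : X) (y : Y) := Γ.measurable_output (v x y) o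
  have det_rectBounded (ω : Coins n) : RectBounded (2 ^ b)
      (fun x y => {ω | (Γ.det ω).output (v x y) = o}.indicator (1 : Coins n → ℝ) ω) := by
    simpa [Set.indicator_apply, hb ω] using (Γ.det ω).rectBounded_output hv o b
  simpa only [outputProb, integral_indicator_one (measurable _ _)] using
    RectBounded.integral det_rectBounded fun x y =>
      (integrable_const (1 : ℝ)).indicator (measurable x y)

end TwoParty

section Disjointness

section Probability

variable {n : ℕ} {V : Type} {Γ : RandomizedProtocol n V Bool} {v : Fin n → V} {p : Prop}

lemma RandomizedProtocol.le_outputProb_false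
    (correct : 2 / 3 ≤ (coinMeasure n).real {ω | (Γ.det ω).output v = true ↔ p}) (hp : ¬p) :
    2 / 3 ≤ Γ.outputProb false v := by
  simpa only [outputProb, hp, iff_false, Bool.not_eq_true] using correct

lemma RandomizedProtocol.outputProb_false_le
    (correct : 2 / 3 ≤ (coinMeasure n).real {ω | (Γ.det ω).output v = true ↔ p}) (hp : p) :
    Γ.outputProb false v ≤ 1 / 3 := by
  have compl_eq : {ω | (Γ.det ω).output v = true ↔ p} = {ω | (Γ.det ω).output v = false}ᶜ := by
    ext ω
    simp [hp]
  rw [compl_eq, probReal_compl_eq_one_sub (Γ.measurable_output v false)] at correct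
  unfold outputProb
  linarith

end Probability

variable {ι : Type*} [Fintype ι]

lemma sum_sum_sum_cube_const [DecidableEq ι] (a : ℝ) :
    ∑ _d : ι → Bool, ∑ _x : ι → Bool, ∑ _y : ι → Bool, a = 8 ^ Fintype.card ι * a := by
  have eight_pow : (8 : ℝ) ^ Fintype.card ι
      = 2 ^ Fintype.card ι * (2 ^ Fintype.card ι * 2 ^ Fintype.card ι) := by
    rw [← mul_pow, ← mul_pow]
    norm_num
  simp [eight_pow, mul_assoc]

lemma mul_le_disjointMass [DecidableEq ι] {P : (ι → Bool) → (ι → Bool) → ℝ} {a : ℝ}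
    (le_P : ∀ x y, Disjoint x y → a ≤ P x y) : 8 ^ Fintype.card ι * a ≤ disjointMass P := by
  rw [← sum_sum_sum_cube_const]
  exact Finset.sum_le_sum fun d _ => Finset.sum_le_sum fun x _ => Finset.sum_le_sum fun y _ =>
    le_P _ _ (disjoint_compl_right.mono inf_le_left inf_le_left)

lemma intersectingMass_le_mul [DecidableEq ι] {P : (ι → Bool) → (ι → Bool) → ℝ} {a : ℝ}
    (P_le : ∀ x y, ¬Disjoint x y → P x y ≤ a) :
    intersectingMass P ≤ Fintype.card ι * (8 ^ Fintype.card ι * a) := by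
  have intersect (i : ι) (x y : ι → Bool) :
      ¬Disjoint (Function.update x i true) (Function.update y i true) := fun h => by
    simpa using Pi.disjoint_iff.1 h i
  calc intersectingMass P
      ≤ ∑ _i : ι, ∑ _d : ι → Bool, ∑ _x : ι → Bool, ∑ _y : ι → Bool, a :=
        Finset.sum_le_sum fun i _ => Finset.sum_le_sum fun d _ => Finset.sum_le_sum fun x _ =>
          Finset.sum_le_sum fun y _ => P_le _ _ (intersect i _ _)
    _ = Fintype.card ι * (8 ^ Fintype.card ι * a) := by
        rw [sum_sum_sum_cube_const, Finset.sum_const, nsmul_eq_mul, Finset.card_univ]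

lemma RectBounded.le_of_separates_disjoint {P : (ι → Bool) → (ι → Bool) → ℝ} {T : ℝ}
    (hP : RectBounded T P) (P_nonneg : ∀ x y, 0 ≤ P x y)
    (le_P : ∀ x y, Disjoint x y → 2 / 3 ≤ P x y)
    (P_le : ∀ x y, ¬Disjoint x y → P x y ≤ 1 / 3) (card_pos : 0 < Fintype.card ι) :
    1 / 243 ≤ 5 / 4 * T ^ 5 * (9 / 10) ^ (Fintype.card ι / 20) := by
  classical
  set N := Fintype.card ι
  -- Taking the fifth power replaces repeating the protocol: `(2 / 3) ^ 5 / 16 > (1 / 3) ^ 5`.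
  have corrupted := hP.pow 5 ((N / 16 : ℝ) • disjointMass - intersectingMass) _
    fun f hf g hg => corruption_bound hf.1 hf.2 hg.1 hg.2
  have disjoint_large : 8 ^ N * (2 / 3) ^ 5 ≤ disjointMass (P ^ 5) :=
    mul_le_disjointMass fun x y h => pow_le_pow_left₀ (by norm_num) (le_P x y h) 5
  have intersecting_small : intersectingMass (P ^ 5) ≤ N * (8 ^ N * (1 / 3) ^ 5) :=
    intersectingMass_le_mul fun x y h => pow_le_pow_left₀ (P_nonneg x y) (P_le x y h) 5
  have disjoint_large_mul := mul_le_mul_of_nonneg_left disjoint_large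
    (by positivity : 0 ≤ (N : ℝ) / 16)
  simp only [LinearMap.sub_apply, LinearMap.smul_apply, smul_eq_mul] at corrupted
  have : (0 : ℝ) < N * 8 ^ N := by positivity
  refine le_of_mul_le_mul_left ?_ this
  linarith

lemma le_of_le_two_pow_mul_pow {N b : ℕ}
    (h : (1 / 243 : ℝ) ≤ 5 / 4 * (2 ^ b) ^ 5 * (9 / 10) ^ (N / 20)) : N ≤ 700 * b + 1260 := by
  have decay : (9 / 10 : ℝ) ^ (N / 20) ≤ (1 / 2) ^ (N / 140) :=
    calc (9 / 10 : ℝ) ^ (N / 20) ≤ (9 / 10) ^ (7 * (N / 140)) :=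
          pow_le_pow_of_le_one (by norm_num) (by norm_num) (by omega)
      _ ≤ (1 / 2) ^ (N / 140) := by
          rw [pow_mul]
          exact pow_le_pow_left₀ (by norm_num) (by norm_num) _
  have two_pow_lt : (2 : ℝ) ^ (N / 140) < 2 ^ (b * 5 + 9) := by
    have : (0 : ℝ) < (2 ^ b) ^ 5 := by positivity
    have := h.trans (mul_le_mul_of_nonneg_left decay (by positivity))
    rw [one_div_pow, mul_one_div, le_div_iff₀ (by positivity)] at this
    rw [pow_add, pow_mul]
    linarith
  have := (pow_lt_pow_iff_right₀ (one_lt_two (α := ℝ))).1 two_pow_lt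
  omega

theorem card_le_of_decides_not_disjoint {n b : ℕ} {V : Type}
    {v : (ι → Bool) → (ι → Bool) → Fin n → V} (hv : IsTwoParty v)
    {Γ : RandomizedProtocol n V Bool} (hb : Γ.CostAtMost b)
    (correct : ∀ x y,
      2 / 3 ≤ (coinMeasure n).real {ω | (Γ.det ω).output (v x y) = true ↔ ¬Disjoint x y}) :
    Fintype.card ι ≤ 700 * b + 1260 := by
  rcases Nat.eq_zero_or_pos (Fintype.card ι) with card_zero | card_pos
  · omega
  · exact le_of_le_two_pow_mul_pow <|
      RectBounded.le_of_separates_disjoint (RandomizedProtocol.rectBounded_outputProb hv hb false)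
        (fun _ _ => measureReal_nonneg)
        (fun x y h => RandomizedProtocol.le_outputProb_false (correct x y) (not_not.2 h))
        (fun x y h => RandomizedProtocol.outputProb_false_le (correct x y) h) card_pos

end Disjointness

section ProtocolConstructions

variable {n : ℕ} {V O O' : Type} {spec : (Fin n → V) → O → Prop}
  {spec' : (Fin n → V) → O' → Prop}

/-- The deterministic protocol in which the players of a list of queries answer in turn, and `i₀`
then declares a function of the answers. -/
def Protocol.queryAll (i₀ : Fin n) : List (Fin n × (V → Bool)) → (List Bool → O) → Protocol n V O
  | [], result => .declare i₀ fun _ => result []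
  | q :: l, result => .send q.1 q.2 fun β => queryAll i₀ l fun answers => result (β :: answers)

lemma Protocol.output_queryAll (i₀ : Fin n) (l : List (Fin n × (V → Bool)))
    (result : List Bool → O) (v : Fin n → V) :
    (queryAll i₀ l result).output v = result (l.map fun q => q.2 (v q.1)) := by
  induction l generalizing result with
  | nil => rfl
  | cons q _ ih => exact ih _

lemma Protocol.bits_queryAll (i₀ : Fin n) (l : List (Fin n × (V → Bool)))
    (result : List Bool → O) (v : Fin n → V) : (queryAll i₀ l result).bits v = l.length := by
  induction l generalizing result with
  | nil => rfl
  | cons q _ ih => exact congrArg (· + 1) (ih _)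

/-- A deterministic protocol as a randomized protocol that ignores the random bits. -/
def RandomizedProtocol.ofDet (π : Protocol n V O) : RandomizedProtocol n V O where
  det _ := π
  measurable_output _ _ := MeasurableSet.const _

lemma RandomizedProtocol.isCorrect_ofDet {π : Protocol n V O} (h : ∀ v, spec v (π.output v)) :
    (ofDet π).IsCorrect spec := by
  intro v
  have : {ω : Coins n | spec v (((ofDet π).det ω).output v)} = Set.univ :=
    Set.eq_univ_of_forall fun _ => h v
  rw [this, probReal_univ]
  norm_num

lemma exists_isCorrect_of_queries [Nonempty O] [NeZero n] {κ : Type*} [Finite κ]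
    (player : κ → Fin n) (query : κ → V → Bool) (solvable : ∀ v, ∃ o, spec v o)
    (determined : ∀ v w, (∀ q, query q (v (player q)) = query q (w (player q))) →
      ∀ o, spec v o → spec w o) :
    ∃ (b : ℕ) (Γ : RandomizedProtocol n V O), Γ.IsCorrect spec ∧ Γ.CostAtMost b := by
  cases nonempty_fintype κ
  let queries := (Finset.univ : Finset κ).toList.map fun q => (player q, query q)
  let answers (v : Fin n → V) := queries.map fun q => q.2 (v q.1)
  have answers_determine {v w : Fin n → V} (h : answers v = answers w) (q : κ) :
      query q (v (player q)) = query q (w (player q)) := by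
    simp only [answers, queries, List.map_map, List.map_inj_left] at h
    exact h q (by simp)
  have : ∀ a, ∃ o, ∀ v, answers v = a → spec v o := by
    intro a
    by_cases ha : ∃ v, answers v = a
    · obtain ⟨v, rfl⟩ := ha
      obtain ⟨o, ho⟩ := solvable v
      exact ⟨o, fun w hw => determined v w (answers_determine hw.symm) o ho⟩
    · exact ⟨Classical.arbitrary O, fun v hv => absurd ⟨v, hv⟩ ha⟩
  choose result result_correct using this
  refine ⟨queries.length, .ofDet (.queryAll 0 queries result),
    RandomizedProtocol.isCorrect_ofDet fun v => ?_, fun _ v => (Protocol.bits_queryAll ..).le⟩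
  rw [Protocol.output_queryAll]
  exact result_correct _ v rfl

/-- The protocol that postprocesses the declared result. -/
def Protocol.map (F : O → O') : Protocol n V O → Protocol n V O'
  | .declare i result => .declare i (F ∘ result)
  | .send i bit next => .send i bit fun β => (next β).map F

lemma Protocol.output_map (F : O → O') (π : Protocol n V O) (v : Fin n → V) :
    (π.map F).output v = F (π.output v) := by
  induction π with
  | declare i result => rfl
  | send i bit _ ih => exact ih _

lemma Protocol.bits_map (F : O → O') (π : Protocol n V O) (v : Fin n → V) :
    (π.map F).bits v = π.bits v := by
  induction π with
  | declare i result => rfl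
  | send i bit _ ih => exact congrArg (· + 1) (ih _)

/-- The randomized protocol that postprocesses the declared result. -/
def RandomizedProtocol.map [Countable O] (F : O → O') (Γ : RandomizedProtocol n V O) :
    RandomizedProtocol n V O' where
  det ω := (Γ.det ω).map F
  measurable_output v o := by
    have : {ω | ((Γ.det ω).map F).output v = o}
        = ⋃ a ∈ {a | F a = o}, {ω | (Γ.det ω).output v = a} := by
      ext ω
      simp [Protocol.output_map]
    rw [this]
    exact MeasurableSet.biUnion (Set.to_countable _) fun a _ => Γ.measurable_output v a

lemma RandomizedProtocol.IsCorrect.map [Countable O] {Γ : RandomizedProtocol n V O}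
    (hΓ : Γ.IsCorrect spec) {F : O → O'} (hF : ∀ v o, spec v o → spec' v (F o)) :
    (Γ.map F).IsCorrect spec' := by
  refine fun v => (hΓ v).trans (measureReal_mono fun ω hω => ?_)
  simp only [RandomizedProtocol.map, Protocol.output_map, Set.mem_ofPred_eq]
  exact hF _ _ hω

lemma RandomizedProtocol.CostAtMost.map [Countable O] {Γ : RandomizedProtocol n V O} {b : ℕ}
    (hb : Γ.CostAtMost b) (F : O → O') : (Γ.map F).CostAtMost b := fun ω v =>
  (Protocol.bits_map F _ v).trans_le (hb ω v)

-- Some correct protocol has to be exhibited, since `randomizedComplexity` is `sInf ∅ = 0` without.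
lemma exists_isCorrect_costAtMost_randomizedComplexity
    (h : ∃ (b : ℕ) (Γ : RandomizedProtocol n V O), Γ.IsCorrect spec ∧ Γ.CostAtMost b) :
    ∃ Γ : RandomizedProtocol n V O, Γ.IsCorrect spec ∧ Γ.CostAtMost (randomizedComplexity spec) :=
  Nat.sInf_mem h

end ProtocolConstructions

section Complexity

variable (n m : ℕ) [NeZero n] (c : ℝ)

open Classical in
lemma exists_isCorrect_findEF :
    ∃ Γ : RandomizedProtocol n (SubmodularValuation m) (Option (Allocation n m)),
      Γ.IsCorrect (findEF n m c) ∧ Γ.CostAtMost (RsubmodEF n m c) := by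
  refine exists_isCorrect_costAtMost_randomizedComplexity <|
    exists_isCorrect_of_queries (κ := Allocation n m × Fin n) (fun q => q.2)
      (fun q v => ∀ j, c * v.1.val (q.1.bundle j) ≤ v.1.val (q.1.bundle q.2))
      (fun v => ?_) fun v w same_answers o ho => ?_
  · by_cases h : ∃ A : Allocation n m, IsEF c v A
    · exact ⟨some h.choose, h.choose_spec⟩
    · exact ⟨none, h⟩
  · have isEF_iff (A : Allocation n m) : IsEF c v A ↔ IsEF c w A :=
      forall_congr' fun i => decide_eq_decide.1 (same_answers (A, i))
    cases o with
    | none => simpa only [findEF, isEF_iff] using ho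
    | some A => exact (isEF_iff A).1 ho

lemma findEF.decideEF_isSome {n m : ℕ} {c : ℝ} {v : Fin n → SubmodularValuation m}
    {o : Option (Allocation n m)} (h : findEF n m c v o) : decideEF n m c v o.isSome := by
  cases o with
  | none => simpa [decideEF, findEF] using h
  | some A => simpa [decideEF] using ⟨A, h⟩

lemma exists_isCorrect_decideEF_costAtMost_RsubmodEF :
    ∃ Γ : RandomizedProtocol n (SubmodularValuation m) Bool,
      Γ.IsCorrect (decideEF n m c) ∧ Γ.CostAtMost (RsubmodEF n m c) := by
  obtain ⟨Γ, hΓ, hb⟩ := exists_isCorrect_findEF n m c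
  exact ⟨Γ.map Option.isSome, hΓ.map fun _ _ => findEF.decideEF_isSome, hb.map _⟩

lemma exists_isCorrect_decideEF :
    ∃ Γ : RandomizedProtocol n (SubmodularValuation m) Bool,
      Γ.IsCorrect (decideEF n m c) ∧ Γ.CostAtMost (RsubmodDecideEF n m c) :=
  exists_isCorrect_costAtMost_randomizedComplexity
    ⟨_, exists_isCorrect_decideEF_costAtMost_RsubmodEF n m c⟩

lemma RsubmodDecideEF_le_RsubmodEF : RsubmodDecideEF n m c ≤ RsubmodEF n m c :=
  Nat.sInf_le (exists_isCorrect_decideEF_costAtMost_RsubmodEF n m c)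

end Complexity

section LevelValue

variable {α : Type*} (k : ℕ) (𝒢 : Set (Finset α)) {S T : Finset α} {g : α}

open Classical in
/-- The value `min (#T) k` of a bundle `T`, lowered by `1 / 2` for the bundles of size `k` outside
`𝒢`. The information about `𝒢` is thus hidden in the level of the bundles of size `k`, where the
marginal values drop from `1` to `0`. -/
noncomputable def levelValue (T : Finset α) : ℝ :=
  if T.card < k then T.card else if T.card = k ∧ T ∉ 𝒢 then k - 1 / 2 else k

variable {k}

lemma levelValue_le : levelValue k 𝒢 T ≤ k := by
  unfold levelValue
  split_ifs with few
  · exact_mod_cast few.le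
  · linarith
  · exact le_rfl

lemma levelValue_of_card_lt (h : T.card < k) : levelValue k 𝒢 T = T.card := if_pos h

lemma levelValue_of_lt_card (h : k < T.card) : levelValue k 𝒢 T = k := by
  rw [levelValue, if_neg (by omega), if_neg (by omega)]

lemma sub_half_le_levelValue (h : k ≤ T.card) : k - 1 / 2 ≤ levelValue k 𝒢 T := by
  rw [levelValue, if_neg h.not_gt]
  split_ifs <;> linarith

lemma levelValue_nonneg (hk : 0 < k) : 0 ≤ levelValue k 𝒢 T := by
  rcases lt_or_ge T.card k with few | many
  · exact (Nat.cast_nonneg _).trans_eq (levelValue_of_card_lt 𝒢 few).symm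
  · have : (1 : ℝ) ≤ k := Nat.one_le_cast.2 hk
    linarith [sub_half_le_levelValue 𝒢 many]

lemma le_levelValue_iff : k ≤ levelValue k 𝒢 T ↔ k < T.card ∨ T.card = k ∧ T ∈ 𝒢 := by
  rcases lt_trichotomy T.card k with h | h | h
  · simp [levelValue_of_card_lt 𝒢 h, h.not_ge, h.ne, h.le]
  · by_cases hT : T ∈ 𝒢 <;> simp [levelValue, h, hT]
  · simp [levelValue_of_lt_card 𝒢 h, h]

variable [DecidableEq α]

lemma levelValue_insert_sub_le_one (hg : g ∉ T) :
    levelValue k 𝒢 (insert g T) - levelValue k 𝒢 T ≤ 1 := by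
  have card_insert := Finset.card_insert_of_notMem hg
  rcases lt_trichotomy (T.card + 1) k with h | rfl | h
  · rw [levelValue_of_card_lt 𝒢 (T := insert g T) (by omega),
      levelValue_of_card_lt 𝒢 (by omega), card_insert]
    push_cast
    linarith
  · have := levelValue_le (k := T.card + 1) 𝒢 (T := insert g T)
    rw [levelValue_of_card_lt 𝒢 (T := T) (by omega)]
    push_cast at this
    linarith
  · have := sub_half_le_levelValue (k := k) 𝒢 (T := T) (by omega)
    linarith [levelValue_le (k := k) 𝒢 (T := insert g T)]

lemma levelValue_insert_sub_eq_one (hg : g ∉ S) (h : S.card + 1 < k) :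
    levelValue k 𝒢 (insert g S) - levelValue k 𝒢 S = 1 := by
  have card_insert := Finset.card_insert_of_notMem hg
  rw [levelValue_of_card_lt 𝒢 (T := insert g S) (by omega),
    levelValue_of_card_lt 𝒢 (by omega), card_insert]
  push_cast
  ring

lemma half_le_levelValue_insert_sub (hg : g ∉ S) (h : S.card < k) :
    1 / 2 ≤ levelValue k 𝒢 (insert g S) - levelValue k 𝒢 S := by
  rcases (Nat.succ_le_of_lt h).lt_or_eq with h | rfl
  · linarith [levelValue_insert_sub_eq_one 𝒢 hg h]
  · have := sub_half_le_levelValue 𝒢 (Finset.card_insert_of_notMem hg).ge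
    rw [levelValue_of_card_lt 𝒢 h]
    push_cast at this
    linarith

lemma levelValue_insert_sub_eq_zero (h : k < T.card) :
    levelValue k 𝒢 (insert g T) - levelValue k 𝒢 T = 0 := by
  have := Finset.card_le_card (Finset.subset_insert g T)
  rw [levelValue_of_lt_card 𝒢 h, levelValue_of_lt_card 𝒢 (by omega), sub_self]

lemma levelValue_insert_sub_le_half (h : k ≤ T.card) :
    levelValue k 𝒢 (insert g T) - levelValue k 𝒢 T ≤ 1 / 2 := by
  linarith [levelValue_le (k := k) 𝒢 (T := insert g T), sub_half_le_levelValue 𝒢 h]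

variable (k) in
omit [DecidableEq α] in
lemma levelValue_mono : Monotone (levelValue k 𝒢) := by
  classical
  refine Finset.monotone_iff_forall_le_insert.2 fun S g hg => ?_
  rcases lt_trichotomy S.card k with h | h | h
  · linarith [half_le_levelValue_insert_sub 𝒢 hg h]
  · have : k < (insert g S).card := by
      rw [Finset.card_insert_of_notMem hg]
      omega
    exact (levelValue_le 𝒢).trans_eq (levelValue_of_lt_card 𝒢 this).symm
  · linarith [levelValue_insert_sub_eq_zero 𝒢 (g := g) h]

variable (k) in
lemma levelValue_insert_sub_antitone (hST : S ⊆ T) (hg : g ∉ T) :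
    levelValue k 𝒢 (insert g T) - levelValue k 𝒢 T
      ≤ levelValue k 𝒢 (insert g S) - levelValue k 𝒢 S := by
  rcases hST.eq_or_ssubset with rfl | hST
  · exact le_rfl
  have card_lt := Finset.card_lt_card hST
  have hgS : g ∉ S := fun h => hg (hST.1 h)
  rcases lt_trichotomy T.card k with h | h | h
  · exact (levelValue_insert_sub_le_one 𝒢 hg).trans_eq
      (levelValue_insert_sub_eq_one 𝒢 hgS (by omega)).symm
  · exact (levelValue_insert_sub_le_half 𝒢 h.ge).trans
      (half_le_levelValue_insert_sub 𝒢 hgS (by omega))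
  · rw [levelValue_insert_sub_eq_zero 𝒢 h, sub_nonneg]
    exact levelValue_mono k 𝒢 (Finset.subset_insert g S)

end LevelValue

section Valuations

variable {m : ℕ}

lemma Valuation.isSubmodular_of_notMem {v : Valuation m}
    (h : ∀ (S T : Finset (Fin m)) (g : Fin m), S ⊆ T → g ∉ T →
      v.val (insert g T) - v.val T ≤ v.val (insert g S) - v.val S) : v.IsSubmodular := by
  intro S T g hST
  by_cases hg : g ∈ T
  · rw [Finset.insert_eq_of_mem hg, sub_self, sub_nonneg]
    exact v.mono _ _ (Finset.subset_insert g S)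
  · exact h S T g hST hg

/-- The valuation of a player who wants only the item `g`. -/
noncomputable def wantsItem (g : Fin m) : SubmodularValuation m where
  val :=
    { val := fun S => if g ∈ S then 1 else 0
      nonneg := fun S => by split_ifs <;> norm_num
      empty := by simp
      mono := fun S T hST => by
        by_cases hg : g ∈ S
        · simp [hg, hST hg]
        · rw [if_neg hg]
          split_ifs <;> norm_num
      pos := by simp }
  property := Valuation.isSubmodular_of_notMem fun S T a hST ha => by
    have haS : a ∉ S := fun h => ha (hST h)
    rcases eq_or_ne g a with rfl | hga
    · simp [ha, haS]
    · simp [hga]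

lemma wantsItem_val (g : Fin m) (S : Finset (Fin m)) :
    (wantsItem g).1.val S = if g ∈ S then 1 else 0 :=
  rfl

variable {k : ℕ} {M : Finset (Fin m)} {w : ℝ}

/-- The level value of the items in `M`, plus the value `w` for each of the other items. -/
noncomputable def levelValuation (hk : 0 < k) (hM : k < M.card) (hw : 0 ≤ w)
    (𝒢 : Set (Finset (Fin m))) : SubmodularValuation m where
  val :=
    { val := fun S => levelValue k 𝒢 (S ∩ M) + w * (S \ M).card
      nonneg := fun S => add_nonneg (levelValue_nonneg 𝒢 hk) (by positivity)
      empty := by simp [levelValue, hk]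
      mono := fun S T hST => by
        have := levelValue_mono k 𝒢 (Finset.inter_subset_inter_right (u := M) hST)
        gcongr
      pos := by
        rw [Finset.univ_inter, levelValue_of_lt_card 𝒢 hM]
        positivity }
  property := Valuation.isSubmodular_of_notMem fun S T g hST hg => by
    have hgS : g ∉ S := fun h => hg (hST h)
    by_cases hgM : g ∈ M
    · have := levelValue_insert_sub_antitone k 𝒢 (Finset.inter_subset_inter_right (u := M) hST)
        (g := g) (by simp [hg])
      simp only [Finset.insert_inter_of_mem hgM, Finset.insert_sdiff_of_mem _ hgM]
      linarith
    · have card_insert (S : Finset (Fin m)) (hg : g ∉ S) :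
          (((insert g S) \ M).card : ℝ) = (S \ M).card + 1 := by
        rw [Finset.insert_sdiff_of_notMem _ hgM, Finset.card_insert_of_notMem (by simp [hg])]
        push_cast
        rfl
      simp only [Finset.insert_inter_of_notMem hgM, card_insert S hgS, card_insert T hg]
      linarith

section LevelValuation

variable (hk : 0 < k) (hM : k < M.card) (hw : 0 ≤ w) (𝒢 : Set (Finset (Fin m)))
  {S : Finset (Fin m)} {g : Fin m}

lemma levelValuation_val (S : Finset (Fin m)) :
    (levelValuation hk hM hw 𝒢).1.val S = levelValue k 𝒢 (S ∩ M) + w * (S \ M).card :=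
  rfl

lemma levelValuation_val_of_subset (hS : S ⊆ M) :
    (levelValuation hk hM hw 𝒢).1.val S = levelValue k 𝒢 S := by
  simp [levelValuation_val, Finset.inter_eq_left.2 hS, Finset.sdiff_eq_empty_iff_subset.2 hS]

lemma levelValuation_val_singleton (hg : g ∉ M) : (levelValuation hk hM hw 𝒢).1.val {g} = w := by
  simp [levelValuation_val, Finset.singleton_inter_of_notMem hg,
    Finset.sdiff_eq_self_of_disjoint (Finset.disjoint_singleton_left.2 hg), levelValue, hk]

lemma le_levelValuation_val (hgS : g ∈ S) (hg : g ∉ M) :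
    w ≤ (levelValuation hk hM hw 𝒢).1.val S :=
  (levelValuation_val_singleton hk hM hw 𝒢 hg).symm.trans_le
    (Valuation.mono _ _ _ (Finset.singleton_subset_iff.2 hgS))

end LevelValuation

end Valuations

section Reduction

variable {n m k : ℕ}

lemma Allocation.mem_bundle {A : Allocation n m} {i : Fin n} {g : Fin m} :
    g ∈ A.bundle i ↔ A g = i := by
  simp [bundle]

lemma Allocation.disjoint_bundle (A : Allocation n m) {i j : Fin n} (h : i ≠ j) :
    Disjoint (A.bundle i) (A.bundle j) :=
  Finset.disjoint_left.2 fun _ hi hj => h ((mem_bundle.1 hi).symm.trans (mem_bundle.1 hj))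

variable (n m k) in
/-- The roles of players and items in the reduction from set disjointness: two distinguished
players divide `2 * k` main items, and each of the other players, of which there is at least one,
has a private item outside the main items. -/
structure Layout where
  alice : Fin n
  bob : Fin n
  alice_ne_bob : alice ≠ bob
  main : Finset (Fin m)
  card_main : main.card = 2 * k
  pos : 0 < k
  privateItem : {i // i ≠ alice ∧ i ≠ bob} ≃ {g // g ∉ main}
  other : {i // i ≠ alice ∧ i ≠ bob}

lemma nonempty_layout (hn : 2 < n) (hk : 0 < k) : Nonempty (Layout n (2 * k + n - 2) k) := by
  obtain ⟨main, -, card_main⟩ := Finset.exists_subset_card_eq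
    (s := (Finset.univ : Finset (Fin (2 * k + n - 2)))) (n := 2 * k) (by simp; omega)
  let alice : Fin n := ⟨0, by omega⟩
  let bob : Fin n := ⟨1, by omega⟩
  have alice_ne_bob : alice ≠ bob := by simp [alice, bob]
  have card_others : Fintype.card {i // i ≠ alice ∧ i ≠ bob} = n - 2 := by
    rw [Fintype.card_of_subtype {alice, bob}ᶜ (by simp), Finset.card_compl,
      Finset.card_pair alice_ne_bob, Fintype.card_fin]
  have card_private : Fintype.card {g // g ∉ main} = n - 2 := by
    rw [Fintype.card_of_subtype mainᶜ (by simp), Finset.card_compl, card_main, Fintype.card_fin]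
    omega
  exact ⟨{
    alice, bob, alice_ne_bob, main, card_main
    pos := hk
    privateItem := Fintype.equivOfCardEq (card_others.trans card_private.symm)
    other := ⟨⟨2, hn⟩, by simp [alice, bob]⟩ }⟩

namespace Layout

variable (L : Layout n m k) {c : ℝ} (hc : 0 < c) (𝒢 ℋ : Set (Finset (Fin m)))

/-- The input of a distinguished player. A private item is worth `k / c`, so that she accepts a
`c`-fraction of it only if her own bundle is worth at least `k`. -/
noncomputable def levelInput : SubmodularValuation m :=
  levelValuation L.pos (by linarith [L.card_main, L.pos] : k < L.main.card)
    (by positivity : 0 ≤ k / c) 𝒢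

/-- The profile in which `𝒢` and `ℋ` are the half-size bundles of full value for the two
distinguished players, and every other player wants only her private item. -/
noncomputable def profile (i : Fin n) : SubmodularValuation m :=
  if h : i ≠ L.alice ∧ i ≠ L.bob then wantsItem (L.privateItem ⟨i, h⟩)
  else if i = L.alice then L.levelInput hc 𝒢 else L.levelInput hc ℋ

lemma profile_alice : L.profile hc 𝒢 ℋ L.alice = L.levelInput hc 𝒢 := by
  simp [profile]

lemma profile_bob : L.profile hc 𝒢 ℋ L.bob = L.levelInput hc ℋ := by
  simp [profile, L.alice_ne_bob.symm]

lemma profile_other (i : {i // i ≠ L.alice ∧ i ≠ L.bob}) :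
    L.profile hc 𝒢 ℋ i = wantsItem (L.privateItem i) :=
  dif_pos i.2

section OfIsEF

variable {L hc 𝒢 ℋ} {A : Allocation n m} (hA : IsEF c (L.profile hc 𝒢 ℋ) A)
include hA

lemma privateItem_mem_bundle (i : {i // i ≠ L.alice ∧ i ≠ L.bob}) :
    (L.privateItem i : Fin m) ∈ A.bundle i := by
  by_contra h
  have := hA i (A (L.privateItem i))
  rw [profile_other, wantsItem_val, wantsItem_val, if_pos (Allocation.mem_bundle.2 rfl),
    if_neg h] at this
  linarith

lemma bundle_subset_main {i : Fin n} (hi : i = L.alice ∨ i = L.bob) : A.bundle i ⊆ L.main := by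
  intro g hg
  by_contra hgM
  let j := L.privateItem.symm ⟨g, hgM⟩
  have : g ∈ A.bundle j := by simpa [j] using privateItem_mem_bundle hA j
  have : i = j := (Allocation.mem_bundle.1 hg).symm.trans (Allocation.mem_bundle.1 this)
  exact hi.elim (this ▸ j.2.1) (this ▸ j.2.2)

lemma le_levelValue_bundle {i : Fin n} (hi : i = L.alice ∨ i = L.bob)
    {𝒥 : Set (Finset (Fin m))} (input_eq : L.profile hc 𝒢 ℋ i = L.levelInput hc 𝒥) :
    k ≤ levelValue k 𝒥 (A.bundle i) := by
  have envy_free := hA i L.other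
  rw [input_eq] at envy_free
  calc (k : ℝ) = c * (k / c) := by field_simp
    _ ≤ c * (L.levelInput hc 𝒥).1.val (A.bundle L.other) := by
        gcongr
        exact le_levelValuation_val _ _ _ _ (privateItem_mem_bundle hA L.other)
          (L.privateItem L.other).2
    _ ≤ (L.levelInput hc 𝒥).1.val (A.bundle i) := envy_free
    _ = levelValue k 𝒥 (A.bundle i) :=
        levelValuation_val_of_subset _ _ _ _ (bundle_subset_main hA hi)

lemma exists_mem_of_isEF : ∃ S ∈ L.main.powersetCard k, S ∈ 𝒢 ∧ L.main \ S ∈ ℋ := by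
  have alice_subset := bundle_subset_main hA (.inl rfl)
  have bob_subset := bundle_subset_main hA (.inr rfl)
  have alice_value := (le_levelValue_iff _).1 <|
    le_levelValue_bundle hA (.inl rfl) (L.profile_alice hc 𝒢 ℋ)
  have bob_value := (le_levelValue_iff _).1 <|
    le_levelValue_bundle hA (.inr rfl) (L.profile_bob hc 𝒢 ℋ)
  have disjoint := A.disjoint_bundle L.alice_ne_bob
  have card_le := Finset.card_le_card (Finset.union_subset alice_subset bob_subset)
  rw [Finset.card_union_of_disjoint disjoint, L.card_main] at card_le
  obtain ⟨alice_card, alice_mem⟩ := alice_value.resolve_left (by omega)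
  obtain ⟨bob_card, bob_mem⟩ := bob_value.resolve_left (by omega)
  have bob_eq : A.bundle L.bob = L.main \ A.bundle L.alice := by
    refine Finset.eq_of_subset_of_card_le (Finset.subset_sdiff.2 ⟨bob_subset, disjoint.symm⟩) ?_
    rw [Finset.card_sdiff_of_subset alice_subset, L.card_main]
    omega
  exact ⟨_, Finset.mem_powersetCard.2 ⟨alice_subset, alice_card⟩, alice_mem, bob_eq ▸ bob_mem⟩

end OfIsEF

section Split

variable {L} {S : Finset (Fin m)}

variable (L S) in
/-- The allocation that gives `S` and the rest of the main items to the distinguished players, and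
every private item to its owner. -/
def split : Allocation n m := fun g =>
  if h : g ∈ L.main then if g ∈ S then L.alice else L.bob else L.privateItem.symm ⟨g, h⟩

lemma bundle_split_alice (hS : S ⊆ L.main) : (L.split S).bundle L.alice = S := by
  ext g
  rw [Allocation.mem_bundle, split]
  split_ifs with hg hgS
  · simp [hgS]
  · simp [hgS, L.alice_ne_bob.symm]
  · simpa [(L.privateItem.symm ⟨g, hg⟩).2.1] using fun hgS => hg (hS hgS)

lemma bundle_split_bob : (L.split S).bundle L.bob = L.main \ S := by
  ext g
  rw [Allocation.mem_bundle, split, Finset.mem_sdiff]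
  split_ifs with hg hgS
  · simp [hgS, L.alice_ne_bob]
  · simp [hg, hgS]
  · simp [hg, (L.privateItem.symm ⟨g, hg⟩).2.2]

lemma bundle_split_other (i : {i // i ≠ L.alice ∧ i ≠ L.bob}) :
    (L.split S).bundle i = {(L.privateItem i : Fin m)} := by
  ext g
  rw [Allocation.mem_bundle, split, Finset.mem_singleton]
  split_ifs with hg hgS
  · exact iff_of_false i.2.1.symm fun h => (L.privateItem i).2 (h ▸ hg)
  · exact iff_of_false i.2.2.symm fun h => (L.privateItem i).2 (h ▸ hg)
  · rw [Subtype.coe_inj, Equiv.symm_apply_eq, Subtype.ext_iff]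

lemma levelInput_split_le (hc1 : c ≤ 1) (hS : S ⊆ L.main) (i : Fin n) :
    c * (L.levelInput hc 𝒢).1.val ((L.split S).bundle i) ≤ k := by
  have main_le {T : Finset (Fin m)} (hT : T ⊆ L.main) :
      c * (L.levelInput hc 𝒢).1.val T ≤ k := by
    rw [levelInput, levelValuation_val_of_subset _ _ _ _ hT]
    exact (mul_le_of_le_one_left (levelValue_nonneg 𝒢 L.pos) hc1).trans (levelValue_le 𝒢)
  by_cases hi : i ≠ L.alice ∧ i ≠ L.bob
  · rw [bundle_split_other ⟨i, hi⟩, levelInput,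
      levelValuation_val_singleton _ _ _ _ (L.privateItem ⟨i, hi⟩).2, mul_div_cancel₀ _ hc.ne']
  · obtain rfl | rfl : i = L.alice ∨ i = L.bob := by tauto
    · exact main_le ((bundle_split_alice hS).trans_subset hS)
    · exact main_le (bundle_split_bob.trans_subset Finset.sdiff_subset)

lemma le_levelInput {T : Finset (Fin m)} (hT : T ⊆ L.main) (card_eq : T.card = k) (mem : T ∈ 𝒢) :
    k ≤ (L.levelInput hc 𝒢).1.val T := by
  rw [levelInput, levelValuation_val_of_subset _ _ _ _ hT]
  exact (le_levelValue_iff 𝒢).2 (.inr ⟨card_eq, mem⟩)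

variable {hc 𝒢 ℋ} in
lemma isEF_split (hc1 : c ≤ 1) (hS : S ∈ L.main.powersetCard k) (alice_mem : S ∈ 𝒢)
    (bob_mem : L.main \ S ∈ ℋ) : IsEF c (L.profile hc 𝒢 ℋ) (L.split S) := by
  obtain ⟨hS, card_S⟩ := Finset.mem_powersetCard.1 hS
  have card_sdiff : (L.main \ S).card = k := by
    rw [Finset.card_sdiff_of_subset hS, L.card_main, card_S]
    omega
  intro i j
  by_cases hi : i ≠ L.alice ∧ i ≠ L.bob
  · rw [L.profile_other hc 𝒢 ℋ ⟨i, hi⟩, wantsItem_val, wantsItem_val, bundle_split_other ⟨i, hi⟩,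
      if_pos (Finset.mem_singleton_self _)]
    split_ifs <;> linarith
  · obtain rfl | rfl : i = L.alice ∨ i = L.bob := by tauto
    · rw [profile_alice]
      refine (levelInput_split_le hc 𝒢 hc1 hS j).trans ?_
      rw [bundle_split_alice hS]
      exact le_levelInput hc 𝒢 hS card_S alice_mem
    · rw [profile_bob]
      refine (levelInput_split_le hc ℋ hc1 hS j).trans ?_
      rw [bundle_split_bob]
      exact le_levelInput hc ℋ Finset.sdiff_subset card_sdiff bob_mem

end Split

lemma exists_isEF_profile_iff (hc1 : c ≤ 1) :
    (∃ A, IsEF c (L.profile hc 𝒢 ℋ) A)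
      ↔ ∃ S ∈ L.main.powersetCard k, S ∈ 𝒢 ∧ L.main \ S ∈ ℋ :=
  ⟨fun ⟨_, hA⟩ => exists_mem_of_isEF hA,
    fun ⟨_, hS, alice_mem, bob_mem⟩ => ⟨_, isEF_split hc1 hS alice_mem bob_mem⟩⟩

/-- The halves of the main items: the coordinates of set disjointness. -/
abbrev HalfSet : Type := {S // S ∈ L.main.powersetCard k}

lemma card_halfSet : Fintype.card L.HalfSet = (2 * k).choose k := by
  rw [Fintype.card_coe, Finset.card_powersetCard, L.card_main]

/-- The family of half sets with a given indicator function. -/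
def halfSets (x : L.HalfSet → Bool) : Set (Finset (Fin m)) := {S | ∃ h, x ⟨S, h⟩ = true}

/-- The profile that encodes a pair of inputs of set disjointness. The second one is encoded by
complements of half sets, so that a common half set splits the main items. -/
noncomputable def disjointnessProfile (x y : L.HalfSet → Bool) : Fin n → SubmodularValuation m :=
  L.profile hc (L.halfSets x) {T | L.main \ T ∈ L.halfSets y}

lemma isTwoParty_disjointnessProfile : IsTwoParty (L.disjointnessProfile hc) := by
  intro i
  by_cases hi : i ≠ L.alice ∧ i ≠ L.bob
  · exact .inl ⟨fun _ => _, fun _ _ => L.profile_other hc _ _ ⟨i, hi⟩⟩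
  · obtain rfl | rfl : i = L.alice ∨ i = L.bob := by tauto
    · exact .inl ⟨_, fun _ _ => L.profile_alice hc _ _⟩
    · exact .inr ⟨_, fun _ _ => L.profile_bob hc _ _⟩

lemma exists_isEF_disjointnessProfile_iff (hc1 : c ≤ 1) (x y : L.HalfSet → Bool) :
    (∃ A, IsEF c (L.disjointnessProfile hc x y) A) ↔ ¬Disjoint x y := by
  have sdiff_sdiff (S : L.HalfSet) : L.main \ (L.main \ S.1) = S.1 :=
    Finset.sdiff_sdiff_eq_self (Finset.mem_powersetCard.1 S.2).1
  rw [disjointnessProfile, exists_isEF_profile_iff _ _ _ _ hc1, Pi.disjoint_iff, not_forall]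
  constructor
  · rintro ⟨S, hS, ⟨_, hx⟩, hy⟩
    obtain ⟨_, hy⟩ : S ∈ L.halfSets y := by simpa [sdiff_sdiff ⟨S, hS⟩] using hy
    exact ⟨⟨S, hS⟩, by simp [hx, hy]⟩
  · rintro ⟨S, hS⟩
    obtain ⟨hx, hy⟩ : x S = true ∧ y S = true := by
      revert hS
      cases x S <;> cases y S <;> simp [disjoint_iff]
    refine ⟨S, S.2, ⟨S.2, hx⟩, ?_⟩
    rw [Set.mem_ofPred_eq, sdiff_sdiff]
    exact ⟨S.2, hy⟩

end Layout

end Reduction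

section LowerBound

variable {n : ℕ} {c : ℝ}

lemma choose_le_RsubmodDecideEF (hn : 2 < n) (hc0 : 0 < c) (hc1 : c ≤ 1) (k : ℕ) :
    (2 * k).choose k ≤ 700 * RsubmodDecideEF n (2 * k + n - 2) c + 1260 := by
  rcases Nat.eq_zero_or_pos k with rfl | hk
  · simp
  have : NeZero n := ⟨by omega⟩
  obtain ⟨L⟩ := nonempty_layout hn hk
  obtain ⟨Γ, hΓ, hb⟩ := exists_isCorrect_decideEF n (2 * k + n - 2) c
  rw [← L.card_halfSet]
  refine card_le_of_decides_not_disjoint (L.isTwoParty_disjointnessProfile hc0) hb fun x y => ?_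
  simpa only [decideEF, L.exists_isEF_disjointnessProfile_iff hc0 hc1]
    using hΓ (L.disjointnessProfile hc0 x y)

lemma isBigO_of_le_mul_add {f R : ℕ → ℕ} {a b : ℕ} (hf : Tendsto f atTop atTop)
    (h : ∀ k, f k ≤ a * R k + b) : (fun k => (f k : ℝ)) =O[atTop] fun k => (R k : ℝ) := by
  refine .of_bound (a + b) ?_
  filter_upwards [hf.eventually_gt_atTop b] with k hk
  have R_pos : 1 ≤ R k := by
    by_contra! R_lt
    have := h k
    simp only [Nat.lt_one_iff.1 R_lt] at this
    omega
  have : f k ≤ (a + b) * R k := by nlinarith [h k]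
  simpa using! (Nat.cast_le (α := ℝ)).2 this

lemma tendsto_choose_two_mul : Tendsto (fun k => (2 * k).choose k) atTop atTop := by
  simpa only [Nat.centralBinom_eq_two_mul_choose] using!
    Nat.centralBinom_strictMono.tendsto_atTop

end LowerBound

end FairDivision

theorem mainTheorem4 (n : ℕ) (hn : 2 < n) (c : ℝ) (hc0 : 0 < c) (hc1 : c ≤ 1) :
    ((fun k : ℕ => ((2 * k).choose k : ℝ)) =O[atTop]
      fun k : ℕ => (FairDivision.RsubmodDecideEF n (2 * k + n - 2) c : ℝ)) ∧
    ((fun k : ℕ => ((2 * k).choose k : ℝ)) =O[atTop]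
      fun k : ℕ => (FairDivision.RsubmodEF n (2 * k + n - 2) c : ℝ)) := by
  have : NeZero n := ⟨by omega⟩
  have decide_bound := FairDivision.choose_le_RsubmodDecideEF hn hc0 hc1
  exact ⟨FairDivision.isBigO_of_le_mul_add FairDivision.tendsto_choose_two_mul decide_bound,
    FairDivision.isBigO_of_le_mul_add FairDivision.tendsto_choose_two_mul fun k =>
      (decide_bound k).trans (by gcongr; exact FairDivision.RsubmodDecideEF_le_RsubmodEF n _ c)⟩
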